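/- For $n\ge 0$ let $B_n$ be the Boolean lattice of all subsets of $\{1,\dots,n\}$ ordered by inclusion. A $t$-chain of a poset is a set of $t$ distinct pairwise comparable elements; let $h_n(t)$ be the number of $t$-chains in $B_n$. A strong embedding $f:P\to Q$ of posets is an injection with $f(x)\le f(y)\iff x\le y$; its image $f(P)$ is an induced copy of $P$ in $Q$. Let $\operatorname{R}^{\sharp}_{k,t}(\mathcal B\,|\,B_{m_1},\dots,B_{m_k})$ be the smallest integer $N\ge 1$ such that for every coloring of the $t$-chains of $B_N$ with colors $1,\dots,k$ there are an $i\in\{1,\dots,k\}$ and an induced copy of $B_{m_i}$ in $B_N$ all of whose $t$-chains have color $i$ (and $\infty$ if there is no such $N$). Theorem. Let $k,t,m_1,\dots,m_k$ be integers with $k\ge 3$, $1\le t-1\le m_1\le m_2\le\cdots\le m_k$ and $m_k\ge 2$. Then $$\operatorname{R}^{\sharp}_{k,t}(\mathcal B\,|\,B_{m_1},\dots,B_{m_k})>\min\left\{m_1+\frac{h_{m_1}(t)+(h_{m_1}(t)-1)\log_2(k-1)-1}{4\binom{m_1}{\lfloor m_1/2\rfloor}},\ m_k+\frac{h_{m_k}(t)-1}{2\binom{m_k}{\lfloor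 m_k/2\rfloor}}\right\}.$$ -/

import Mathlib

open scoped ENNReal

/-- A `t`-chain of a poset `α`: a set of `t` distinct pairwise comparable elements. -/
def TChain (α : Type*) [PartialOrder α] (t : ℕ) : Type _ :=
  {C : Finset α // C.card = t ∧ IsChain (· ≤ ·) (C : Set α)}

/-- The Boolean lattice `B_n`: the power set of an `n`-element set ordered by inclusion. -/
abbrev BooleanLattice (n : ℕ) : Type := Finset (Fin n)

/-- `h_n(t)`, the number of `t`-chains in `B_n`. -/
noncomputable def chainCount (n t : ℕ) : ℕ := Nat.card (TChain (BooleanLattice n) t)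

/-- The coloring `c` of the `t`-chains of `Q` has a monochromatic induced copy of `P` in color `i`:
there is a strong embedding `f : P → Q` (`f x ≤ f y ↔ x ≤ y`) such that every `t`-chain of `Q`
contained in `f(P)` has color `i`. -/
def HasMonoInducedCopy {Q : Type*} [PartialOrder Q] {k t : ℕ} (c : TChain Q t → Fin k)
    (P : Type*) [PartialOrder P] (i : Fin k) : Prop :=
  ∃ f : P ↪o Q, ∀ C : TChain Q t, (C.val : Set Q) ⊆ Set.range f → c C = i

/-- Every `k`-coloring of the `t`-chains of `Q` contains, for some `i`, a monochromatic induced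
copy of `P i` in color `i`. -/
def StronglyArrows (Q : Type*) [PartialOrder Q] {k : ℕ} (t : ℕ)
    (P : Fin k → Type*) [∀ i, PartialOrder (P i)] : Prop :=
  ∀ c : TChain Q t → Fin k, ∃ i : Fin k, HasMonoInducedCopy c (P i) i

/-- The strong poset Ramsey number for `t`-chains of the host family `{Q_n : n ≥ 1}`: the least
`N ≥ 1` such that `Q_N` strongly arrows `(P_1, …, P_k)`, and `⊤` if there is no such `N`. -/
noncomputable def strongPosetRamsey (Q : ℕ → Type*) [∀ n, PartialOrder (Q n)] {k : ℕ} (t : ℕ)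
    (P : Fin k → Type*) [∀ i, PartialOrder (P i)] : ℕ∞ :=
  ⨅ (N : ℕ) (_ : 1 ≤ N ∧ StronglyArrows (Q N) t P), (N : ℕ∞)

/-- The strong Boolean Ramsey number of `B_{m_1}, …, B_{m_k}` for `t`-chains. -/
noncomputable def strongBooleanRamsey {k : ℕ} (t : ℕ) (m : Fin k → ℕ) : ℕ∞ :=
  strongPosetRamsey BooleanLattice t (fun i => BooleanLattice (m i))

/-- `a + (h_a(t) + (h_a(t) - 1) log₂(k - 1) - 1) / (4 * C(a, ⌊a/2⌋))`. -/
noncomputable def firstBound (k t a : ℕ) : ℝ :=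
  (a : ℝ) + ((chainCount a t : ℝ) + ((chainCount a t : ℝ) - 1) * Real.logb 2 ((k : ℝ) - 1) - 1)
    / (4 * (a.choose (a / 2) : ℝ))

/-- `b + (h_b(t) - 1) / (2 * C(b, ⌊b/2⌋))`. -/
noncomputable def secondBound (t b : ℕ) : ℝ :=
  (b : ℝ) + ((chainCount b t : ℝ) - 1) / (2 * (b.choose (b / 2) : ℝ))

/-! The proof is a union bound over colorings. An induced copy of $B_m$ in $B_N$ is fixed by an
$m$-set $X$ and, for each of the $N-m$ points outside $X$, an up-set of $2^X$
(`exists_range_eq_graphOver`). With $c=\binom{m}{\lfloor m/2\rfloor}$, Hansel's bound $3^c$ on the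
number of up-sets gives at most $8^{c(N-m)}$ copies when $N\ge m$ (`card_inducedCopies_le`).

A copy is monochromatic in a given color for at most a fraction $k^{-h_m(t)}$ of all colorings. If
$N$ is at most the first bound for $m$, then $8^{c(N-m)}\le k^{h_m(t)-1}$ (`eight_pow_le`), so each
color is bad for at most a $1/k$ fraction of the colorings, and for strictly less when $m\ge 2$.
Hence some coloring avoids all copies. The first bound increases with $m$ (`firstBound_mono`), so
$m_1$ alone decides, and the first term of the minimum already suffices. -/

/-! ### Symmetric chain decompositions -/

/-- A decomposition of the subsets of `{0, …, n - 1}` into symmetric chains. The chain `i` has one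
member `mem i j` of each size `j` with `low i ≤ j ≤ n - low i`. Whenever three consecutive members
of a chain are given, the interval that they span meets a shorter chain. -/
structure SymmetricChains (n : ℕ) where
  ι : Type
  fin : Fintype ι
  low : ι → ℕ
  mem : ι → ℕ → Finset ℕ
  two_low_le : ∀ i, 2 * low i ≤ n
  subset_range : ∀ i j, low i ≤ j → j + low i ≤ n → mem i j ⊆ Finset.range n
  card_mem : ∀ i j, low i ≤ j → j + low i ≤ n → (mem i j).card = j
  mono : ∀ i j j', low i ≤ j → j ≤ j' → j' + low i ≤ n → mem i j ⊆ mem i j'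
  inj : ∀ i i' j, low i ≤ j → j + low i ≤ n → low i' ≤ j → j + low i' ≤ n →
    mem i j = mem i' j → i = i'
  surj : ∀ S ⊆ Finset.range n, ∃ i j, low i ≤ j ∧ j + low i ≤ n ∧ mem i j = S
  shorter : ∀ i j, low i ≤ j → j + 2 + low i ≤ n → ∃ i', low i < low i' ∧ low i' ≤ j + 1 ∧
    j + 1 + low i' ≤ n ∧ mem i j ⊆ mem i' (j + 1) ∧ mem i' (j + 1) ⊆ mem i (j + 2)

namespace SymmetricChains

/-- The trivial decomposition of the subsets of the empty set. -/
def zero : SymmetricChains 0 where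
  ι := Unit
  fin := inferInstance
  low _ := 0
  mem _ _ := ∅
  two_low_le := by simp
  subset_range := by simp
  card_mem := by simp
  mono := by simp
  inj := by simp
  surj S hS := ⟨(), 0, by simp_all⟩
  shorter i j h h' := by omega

theorem notMem_of_subset_range {n : ℕ} {S : Finset ℕ} (h : S ⊆ Finset.range n) : n ∉ S :=
  fun hn => by simpa using h hn

theorem insert_cancel {n : ℕ} {S T : Finset ℕ} (hS : S ⊆ Finset.range n)
    (hT : T ⊆ Finset.range n) (h : insert n S = insert n T) : S = T := by
  rw [← Finset.erase_insert (notMem_of_subset_range hS), h,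
    Finset.erase_insert (notMem_of_subset_range hT)]

/-- The chain `i` extended by adding the new point to its top. -/
def longMem {n : ℕ} (D : SymmetricChains n) (i : D.ι) (j : ℕ) : Finset ℕ :=
  if j + D.low i ≤ n then D.mem i j else insert n (D.mem i (n - D.low i))

/-- The chain `i` without its top, with the new point added to all members. -/
def shortMem {n : ℕ} (D : SymmetricChains n) (i : D.ι) (j : ℕ) : Finset ℕ :=
  insert n (D.mem i (j - 1))

theorem longMem_of_le {n : ℕ} (D : SymmetricChains n) {i : D.ι} {j : ℕ} (h : j + D.low i ≤ n) :
    D.longMem i j = D.mem i j := if_pos h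

theorem longMem_of_lt {n : ℕ} (D : SymmetricChains n) {i : D.ι} {j : ℕ} (h : n < j + D.low i) :
    D.longMem i j = insert n (D.mem i (n - D.low i)) := if_neg (by omega)

open Classical in
/-- The inductive step of the construction. -/
noncomputable def succ {n : ℕ} (D : SymmetricChains n) : SymmetricChains (n + 1) where
  ι := D.ι ⊕ {i : D.ι // 2 * D.low i < n}
  fin := by have := D.fin; infer_instance
  low := Sum.elim D.low (fun i => D.low i + 1)
  mem := Sum.elim D.longMem (fun i => D.shortMem i)
  two_low_le := by
    rintro (i | ⟨i, hi⟩)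
    · have := D.two_low_le i; simp; omega
    · simp; omega
  subset_range := by
    rintro (i | ⟨i, hi⟩) j h1 h2 <;> simp only [Sum.elim_inl, Sum.elim_inr] at h1 h2 ⊢ <;>
      rw [Finset.range_add_one]
    · have := D.two_low_le i
      rcases le_or_gt (j + D.low i) n with h | h
      · rw [D.longMem_of_le h]
        exact (D.subset_range i j h1 h).trans (Finset.subset_insert _ _)
      · rw [D.longMem_of_lt h]
        exact Finset.insert_subset_insert _ (D.subset_range i _ (by omega) (by omega))
    · exact Finset.insert_subset_insert _ (D.subset_range i _ (by omega) (by omega))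
  card_mem := by
    rintro (i | ⟨i, hi⟩) j h1 h2 <;> simp only [Sum.elim_inl, Sum.elim_inr] at h1 h2 ⊢
    · have := D.two_low_le i
      rcases le_or_gt (j + D.low i) n with h | h
      · rw [D.longMem_of_le h]
        exact D.card_mem i j h1 h
      · rw [D.longMem_of_lt h, Finset.card_insert_of_notMem (notMem_of_subset_range
          (D.subset_range i _ (by omega) (by omega))), D.card_mem i _ (by omega) (by omega)]
        omega
    · rw [shortMem, Finset.card_insert_of_notMem (notMem_of_subset_range
          (D.subset_range i _ (by omega) (by omega))), D.card_mem i _ (by omega) (by omega)]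
      omega
  mono := by
    rintro (i | ⟨i, hi⟩) j j' h1 h2 h3 <;> simp only [Sum.elim_inl, Sum.elim_inr] at h1 h3 ⊢
    · rcases le_or_gt (j' + D.low i) n with h | h
      · rw [D.longMem_of_le h, D.longMem_of_le (by omega)]
        exact D.mono i _ _ h1 h2 h
      · rw [D.longMem_of_lt h]
        rcases le_or_gt (j + D.low i) n with h' | h'
        · rw [D.longMem_of_le h']
          exact (D.mono i _ _ h1 (by omega) (by omega)).trans (Finset.subset_insert _ _)
        · rw [D.longMem_of_lt h']
    · exact Finset.insert_subset_insert _ (D.mono i _ _ (by omega) (by omega) (by omega))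
  inj := by
    -- A common member would contain `n`, hence be the added top of a long chain; erasing `n` forces
    -- the same original chain, whose top the short version omits.
    have key : ∀ (i : D.ι) (i' : {i : D.ι // 2 * D.low i < n}) (j : ℕ), D.low i ≤ j →
        D.low i' + 1 ≤ j → j + (D.low i' + 1) ≤ n + 1 → D.longMem i j ≠ D.shortMem i' j := by
      rintro i ⟨i', hi'⟩ j h1 h2 h3 h
      have := D.two_low_le i
      have hs := D.subset_range i' (j - 1) (by simp at h2; omega) (by simp at h3; omega)
      simp only at h2 h3
      rcases le_or_gt (j + D.low i) n with hj | hj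
      · rw [D.longMem_of_le hj] at h
        exact notMem_of_subset_range (D.subset_range i j h1 hj) (h ▸ Finset.mem_insert_self _ _)
      · rw [D.longMem_of_lt hj] at h
        have h' := insert_cancel (D.subset_range i _ (by omega) (by omega)) hs h
        have hc := congrArg Finset.card h'
        rw [D.card_mem _ _ (by omega) (by omega), D.card_mem _ _ (by omega) (by omega)] at hc
        rw [hc] at h'
        obtain rfl := D.inj _ _ _ (by omega) (by omega) (by omega) (by omega) h'
        omega
    rintro (i | i) (i' | i') j h1 h2 h3 h4 h <;>
      simp only [Sum.elim_inl, Sum.elim_inr] at h1 h2 h3 h4 h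
    · have := D.two_low_le i
      have := D.two_low_le i'
      rcases le_or_gt (j + D.low i) n with hj | hj <;>
        rcases le_or_gt (j + D.low i') n with hj' | hj'
      · rw [D.longMem_of_le hj, D.longMem_of_le hj'] at h
        rw [D.inj _ _ _ h1 hj h3 hj' h]
      · rw [D.longMem_of_le hj, D.longMem_of_lt hj'] at h
        exact absurd (h ▸ Finset.mem_insert_self _ _ : n ∈ D.mem i j)
          (notMem_of_subset_range (D.subset_range i j h1 hj))
      · rw [D.longMem_of_lt hj, D.longMem_of_le hj'] at h
        exact absurd (h ▸ Finset.mem_insert_self _ _ : n ∈ D.mem i' j)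
          (notMem_of_subset_range (D.subset_range i' j h3 hj'))
      · rw [D.longMem_of_lt hj, D.longMem_of_lt hj'] at h
        have h' := insert_cancel (D.subset_range i _ (by omega) (by omega))
          (D.subset_range i' _ (by omega) (by omega)) h
        rw [show n - D.low i' = n - D.low i by omega] at h'
        rw [D.inj _ _ _ (by omega) (by omega) (by omega) (by omega) h']
    · exact absurd h (key i i' j h1 h3 h4)
    · exact absurd h.symm (key i' i j h3 h1 h2)
    · have h' := insert_cancel (D.subset_range i _ (by omega) (by omega))
          (D.subset_range i' _ (by omega) (by omega)) h
      rw [Subtype.ext (D.inj _ _ _ (by omega) (by omega) (by omega) (by omega) h')]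
  surj := by
    intro S hS
    by_cases hn : n ∈ S
    · obtain ⟨i, j, h1, h2, h3⟩ := D.surj (S.erase n) (by
        intro x hx
        have := hS (Finset.mem_of_mem_erase hx)
        have := Finset.ne_of_mem_erase hx
        simp at *; omega)
      rcases eq_or_lt_of_le h2 with h | h
      · refine ⟨Sum.inl i, j + 1, by simp; omega, by simp; omega, ?_⟩
        simp only [Sum.elim_inl]
        rw [D.longMem_of_lt (by omega), show n - D.low i = j by omega, h3, Finset.insert_erase hn]
      · refine ⟨Sum.inr ⟨i, by omega⟩, j + 1, by simp; omega, by simp; omega, ?_⟩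
        simp only [Sum.elim_inr, shortMem, Nat.add_sub_cancel]
        rw [h3, Finset.insert_erase hn]
    · obtain ⟨i, j, h1, h2, h3⟩ := D.surj S (by
        intro x hx
        have := hS hx
        have : x ≠ n := fun h => hn (h ▸ hx)
        simp at *; omega)
      exact ⟨Sum.inl i, j, h1, by simp; omega, by simp [D.longMem_of_le h2, h3]⟩
  shorter := by
    rintro (i | ⟨i, hi⟩) j h1 h2 <;> simp only [Sum.elim_inl, Sum.elim_inr] at h1 h2 ⊢
    · rcases le_or_gt (j + 2 + D.low i) n with h | h
      · obtain ⟨i', h3, h4, h5, h6, h7⟩ := D.shorter i j h1 h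
        refine ⟨Sum.inl i', h3, h4, by simp; omega, ?_⟩
        simp only [Sum.elim_inl]
        rw [D.longMem_of_le h, D.longMem_of_le h5, D.longMem_of_le (by omega)]
        exact ⟨h6, h7⟩
      -- Here `j + 2` is the added top, and the short version of the same chain supplies the middle
      -- set.
      · refine ⟨Sum.inr ⟨i, by omega⟩, by simp, by simp; omega, by simp; omega, ?_⟩
        simp only [Sum.elim_inr, shortMem, Nat.add_sub_cancel]
        rw [D.longMem_of_lt h, D.longMem_of_le (by omega)]
        exact ⟨Finset.subset_insert _ _,
          Finset.insert_subset_insert _ (D.mono i _ _ h1 (by omega) (by omega))⟩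
    · obtain ⟨i', h3, h4, h5, h6, h7⟩ := D.shorter i (j - 1) (by omega) (by omega)
      rw [show j - 1 + 1 = j by omega] at h4 h5 h6 h7
      rw [show j - 1 + 2 = j + 1 by omega] at h7
      -- If `j` is the top level of `i'`, the short version lacks it and the long version is used;
      -- its `low` is still large enough, because `j + low i' = n`.
      rcases eq_or_lt_of_le h5 with h | h
      · refine ⟨Sum.inl i', by simp; omega, by simp; omega, by simp; omega, ?_⟩
        simp only [Sum.elim_inl, shortMem]
        rw [D.longMem_of_lt (by omega), show n - D.low i' = j by omega]
        exact ⟨Finset.insert_subset_insert _ h6, Finset.insert_subset_insert _ h7⟩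
      · refine ⟨Sum.inr ⟨i', by omega⟩, by simp; omega, by simp; omega, by simp; omega, ?_⟩
        simp only [Sum.elim_inr, shortMem, Nat.add_sub_cancel]
        exact ⟨Finset.insert_subset_insert _ h6, Finset.insert_subset_insert _ h7⟩

/-- The decomposition of the subsets of `{0, …, n - 1}` obtained by iteration. -/
noncomputable def of : ∀ n : ℕ, SymmetricChains n
  | 0 => zero
  | n + 1 => (of n).succ

/-- Every symmetric chain crosses the middle level, in a set of its own. -/
theorem card_le {n : ℕ} (D : SymmetricChains n) : Nat.card D.ι ≤ n.choose (n / 2) := by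
  have hb : ∀ i, D.low i ≤ n / 2 ∧ n / 2 + D.low i ≤ n := fun i => by
    have := D.two_low_le i; omega
  have : Function.Injective
      (fun i => (⟨D.mem i (n / 2), Finset.mem_powersetCard.2
        ⟨D.subset_range i _ (hb i).1 (hb i).2, D.card_mem i _ (hb i).1 (hb i).2⟩⟩ :
        Finset.powersetCard (n / 2) (Finset.range n))) := fun i i' h =>
    D.inj i i' (n / 2) (hb i).1 (hb i).2 (hb i').1 (hb i').2 (congrArg Subtype.val h)
  simpa only [Nat.card_eq_fintype_card (α := Finset.powersetCard _ _), Fintype.card_coe,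
    Finset.card_powersetCard, Finset.card_range] using Nat.card_le_card_of_injective _ this

end SymmetricChains

/-! ### Hansel's bound on the number of up-sets -/

theorem exists_add_two_le_of_two_lt_card {s : Finset ℕ} (h : 2 < s.card) :
    ∃ x ∈ s, ∃ z ∈ s, x + 2 ≤ z := by
  have hne : s.Nonempty := Finset.card_pos.1 (by omega)
  by_contra! hcon
  have : s ⊆ Finset.Ico (s.min' hne) (s.min' hne + 2) := fun z hz =>
    Finset.mem_Ico.2 ⟨s.min'_le z hz, hcon _ (s.min'_mem hne) z hz⟩
  have := Finset.card_le_card this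
  simp at this
  omega

open Classical in
/-- Hansel's bound on the Dedekind numbers. -/
theorem card_upperSet_finset_le (α : Type*) [Fintype α] :
    Nat.card (UpperSet (Finset α)) ≤
      3 ^ ((Fintype.card α).choose (Fintype.card α / 2)) := by
  set n := Fintype.card α with hn
  let D := SymmetricChains.of n
  have := D.fin
  let p : Finset ℕ → Finset α := fun S => Finset.univ.filter fun a => (Fintype.equivFin α a).val ∈ S
  have hp : ∀ {S T}, S ⊆ T → p S ≤ p T := fun h a ha => by
    simp only [p, Finset.mem_filter] at ha ⊢; exact ⟨ha.1, h ha.2⟩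
  let A : UpperSet (Finset α) → D.ι → Finset ℕ := fun U i =>
    (Finset.Icc (D.low i) (n - D.low i)).filter fun j => p (D.mem i j) ∈ U
  have hA : ∀ U i j, j ∈ A U i ↔ (D.low i ≤ j ∧ j + D.low i ≤ n) ∧ p (D.mem i j) ∈ U := by
    intro U i j
    have := D.two_low_le i
    simp only [A, Finset.mem_filter, Finset.mem_Icc]
    constructor <;> rintro ⟨h1, h2⟩ <;> exact ⟨by omega, h2⟩
  have hnest : ∀ U V i, A U i ⊆ A V i ∨ A V i ⊆ A U i := by
    intro U V i
    by_contra! hcon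
    obtain ⟨x, hx, hx'⟩ := Finset.not_subset.1 hcon.1
    obtain ⟨y, hy, hy'⟩ := Finset.not_subset.1 hcon.2
    rw [hA] at hx hx' hy hy'
    rcases le_total x y with h | h
    · exact hy' ⟨hy.1, U.upper (hp (D.mono i x y hx.1.1 h hy.1.2)) hx.2⟩
    · exact hx' ⟨hx.1, V.upper (hp (D.mono i y x hy.1.1 h hx.1.2)) hy.2⟩
  -- Among three levels in the difference, two are at distance at least 2. The shorter chain passing
  -- between them, where `U` and `V` agree, pushes the upper one into `V`.
  have hdiff : ∀ U V i, (∀ i', D.low i < D.low i' → A U i' = A V i') →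
      (A U i \ A V i).card ≤ 2 := by
    intro U V i hlow
    by_contra! hcon
    obtain ⟨x, hx, z, hz, hxz⟩ := exists_add_two_le_of_two_lt_card hcon
    rw [Finset.mem_sdiff, hA, hA] at hx hz
    obtain ⟨i', h1, h2, h3, h4, h5⟩ := D.shorter i x hx.1.1.1 (by omega)
    have hU : x + 1 ∈ A U i' := (hA _ _ _).2 ⟨⟨h2, h3⟩, U.upper (hp h4) hx.1.2⟩
    rw [hlow i' h1, hA] at hU
    exact hz.2 ⟨hz.1.1, V.upper (hp (h5.trans
      (D.mono i _ _ (by omega) hxz (by omega)))) hU.2⟩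
  -- Induction from short chains to long ones: the traces on a chain are nested and differ by at
  -- most two levels, so the size modulo 3 determines the trace.
  have heq : ∀ U V, (∀ i, (A U i).card % 3 = (A V i).card % 3) → ∀ d i, n - D.low i = d →
      A U i = A V i := by
    intro U V hUV d
    induction d using Nat.strong_induction_on with
    | _ d ih =>
      intro i hi
      have hlow : ∀ i', D.low i < D.low i' → A U i' = A V i' := fun i' h' => by
        have := D.two_low_le i'
        exact ih _ (by omega) i' rfl
      have h1 := hdiff U V i hlow
      have h2 := hdiff V U i fun i' h' => (hlow i' h').symm
      have h3 := hUV i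
      rcases hnest U V i with h | h
      · have := Finset.card_sdiff_add_card_eq_card h
        exact Finset.eq_of_subset_of_card_le h (by omega)
      · have := Finset.card_sdiff_add_card_eq_card h
        exact (Finset.eq_of_subset_of_card_le h (by omega)).symm
  have hinj : Function.Injective fun (U : UpperSet (Finset α)) (i : D.ι) =>
      (⟨(A U i).card % 3, Nat.mod_lt _ (by norm_num)⟩ : Fin 3) := by
    intro U V h
    have hUV := heq U V fun i => congrArg Fin.val (congrFun h i)
    ext S
    obtain ⟨i, j, h1, h2, h3⟩ := D.surj (S.image fun a => (Fintype.equivFin α a).val) (by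
      intro x hx
      obtain ⟨a, -, rfl⟩ := Finset.mem_image.1 hx
      exact Finset.mem_range.2 (Fin.is_lt _))
    have hS : p (D.mem i j) = S := by
      ext a
      simp [p, h3, Fin.val_inj]
    have := hUV _ i rfl
    have := congrArg (j ∈ ·) this
    simpa [hA, h1, h2, hS] using this
  calc Nat.card (UpperSet (Finset α)) ≤ Nat.card (D.ι → Fin 3) :=
        Nat.card_le_card_of_injective _ hinj
    _ = 3 ^ Nat.card D.ι := by simp
    _ ≤ _ := Nat.pow_le_pow_right (by norm_num) D.card_le

/-! ### Binomial estimates -/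

theorem choose_add_le_pow (m d : ℕ) : (m + d).choose m ≤ (m + 1) ^ d := by
  induction d with
  | zero => simp
  | succ d ih =>
    have h := Nat.add_one_mul_choose_eq (m + d) d
    rw [Nat.choose_symm_add] at ih
    rw [Nat.choose_symm_add, ← add_assoc]
    refine Nat.le_of_mul_le_mul_right (c := d + 1) ?_ (by omega)
    rw [← h, pow_succ]
    calc (m + d + 1) * (m + d).choose d ≤ ((m + 1) * (d + 1)) * (m + 1) ^ d :=
          Nat.mul_le_mul (by nlinarith) ih
      _ = _ := by ring

theorem succ_le_two_pow_choose_middle (m : ℕ) : m + 1 ≤ 2 ^ (m.choose (m / 2)) :=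
  calc m + 1 ≤ 2 ^ m := Nat.lt_two_pow_self
    _ = 2 ^ m.choose 1 := by simp
    _ ≤ _ := Nat.pow_le_pow_right (by norm_num) (Nat.choose_le_middle 1 m)

theorem choose_succ_middle_le (m : ℕ) :
    (m + 1).choose ((m + 1) / 2) ≤ 2 * m.choose (m / 2) := by
  rcases h : (m + 1) / 2 with _ | j
  · have : 0 < m.choose (m / 2) := Nat.choose_pos (by omega)
    simp; omega
  · rw [Nat.choose_succ_succ']
    have := Nat.choose_le_middle j m
    have := Nat.choose_le_middle (j + 1) m
    omega

/-! ### Structure and number of induced copies -/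

/-- The sets `T` in which membership of the points outside `X` is determined by `T ∩ X` through
given up-sets. -/
def graphOver {N : ℕ} (X : Finset (Fin N)) (φ : {y // y ∉ X} → UpperSet (Finset X)) :
    Set (Finset (Fin N)) :=
  {T | ∀ y : {y // y ∉ X}, y.val ∈ T ↔ T.subtype (· ∈ X) ∈ φ y}

/-- Choose `x i` in `f {i}` but not in `f {i}ᶜ`. Monotonicity makes `x i ∈ f S` equivalent to `i ∈
S`, so the trace on `X` recovers `S`, and membership of any other point is monotone in it. -/
theorem exists_range_eq_graphOver {m N : ℕ} (f : BooleanLattice m ↪o BooleanLattice N) :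
    ∃ X : Finset (Fin N), X.card = m ∧ ∃ φ, Set.range f = graphOver X φ := by
  classical
  have hex : ∀ i : Fin m, ∃ x, x ∈ f {i} ∧ x ∉ f {i}ᶜ := fun i => by
    have : ¬ f {i} ≤ f {i}ᶜ := by
      rw [f.le_iff_le]
      intro h
      simpa using h (Finset.mem_singleton_self i)
    exact Finset.not_subset.1 this
  choose x hx hx' using hex
  have hmem : ∀ i S, x i ∈ f S ↔ i ∈ S := by
    intro i S
    constructor
    · intro h
      by_contra hi
      exact hx' i (f.monotone (show S ≤ {i}ᶜ from fun j hj => by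
        simp only [Finset.mem_compl, Finset.mem_singleton]; rintro rfl; exact hi hj) h)
    · intro hi
      exact f.monotone (show {i} ≤ S from Finset.singleton_subset_iff.2 hi) (hx i)
  have hinj : Function.Injective x := fun i j h => by
    have := (hmem i {j}).1 (h ▸ hx j)
    simpa using this
  let φ : {y // y ∉ Finset.univ.image x} → UpperSet (Finset (Finset.univ.image x)) := fun y =>
    ⟨{S | y.val ∈ f (Finset.univ.filter fun i => ∃ z ∈ S, z.val = x i)}, by
      intro S T hST hS
      refine f.monotone (show _ ≤ _ from ?_) hS
      intro i hi
      simp only [Finset.mem_filter, Finset.mem_univ, true_and] at hi ⊢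
      obtain ⟨z, hz, hzi⟩ := hi
      exact ⟨z, hST hz, hzi⟩⟩
  refine ⟨Finset.univ.image x, by simp [Finset.card_image_of_injective _ hinj], φ, ?_⟩
  have hback : ∀ T : Finset (Fin N), (Finset.univ.filter fun i =>
      ∃ z ∈ T.subtype (· ∈ Finset.univ.image x), z.val = x i) =
      Finset.univ.filter fun i => x i ∈ T := by
    intro T
    ext i
    simp only [Finset.mem_filter, Finset.mem_univ, true_and, Finset.mem_subtype]
    constructor
    · rintro ⟨z, hz, hzi⟩
      exact hzi ▸ hz
    · intro h
      exact ⟨⟨x i, by simp⟩, h, rfl⟩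
  ext T
  have hiff : T ∈ graphOver (Finset.univ.image x) φ ↔ ∀ y : {y // y ∉ Finset.univ.image x},
      y.val ∈ T ↔ y.val ∈ f (Finset.univ.filter fun i => x i ∈ T) :=
    forall_congr' fun y => by rw [← hback T]; rfl
  rw [hiff, Set.mem_range]
  constructor
  · rintro ⟨S, rfl⟩ y
    simp [hmem]
  · intro h
    refine ⟨Finset.univ.filter fun i => x i ∈ T, ?_⟩
    ext y
    by_cases hy : y ∈ Finset.univ.image x
    · obtain ⟨i, -, rfl⟩ := Finset.mem_image.1 hy
      simp [hmem]
    · exact (h ⟨y, hy⟩).symm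

open Classical in
/-- The induced copies of `B_m` in `B_N`. -/
noncomputable def inducedCopies (m N : ℕ) : Finset (Set (BooleanLattice N)) :=
  Finset.univ.filter fun Z => ∃ f : BooleanLattice m ↪o BooleanLattice N, Set.range f = Z

theorem mem_inducedCopies {m N : ℕ} {Z : Set (BooleanLattice N)} :
    Z ∈ inducedCopies m N ↔ ∃ f : BooleanLattice m ↪o BooleanLattice N, Set.range f = Z := by
  simp [inducedCopies]

/-- The base is `8 = 2 * 4`: the choice of `X` costs a factor `2`, and Hansel's `3` is rounded up to
`4`. -/
theorem card_inducedCopies_le (m N : ℕ) :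
    (inducedCopies m N).card ≤ 8 ^ (m.choose (m / 2) * (N - m)) := by
  classical
  -- For `N < m` the exponent truncates to 0, but there are no copies.
  rcases lt_or_ge N m with hlt | hle
  · have : inducedCopies m N = ∅ := by
      refine Finset.eq_empty_of_forall_notMem fun Z hZ => ?_
      obtain ⟨f, -⟩ := mem_inducedCopies.1 hZ
      obtain ⟨X, hX, -⟩ := exists_range_eq_graphOver f
      have := X.card_le_univ
      simp at this
      omega
    simp [this]
  obtain ⟨d, rfl⟩ := Nat.exists_eq_add_of_le hle
  rw [Nat.add_sub_cancel_left]
  have hfin : ∀ X : Finset (Fin (m + d)), Finite (UpperSet (Finset X)) := fun X =>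
    Finite.of_injective (fun U => (U : Set (Finset X))) SetLike.coe_injective
  have hfib : ∀ X : Finset (Fin (m + d)), Fintype (UpperSet (Finset X)) := fun X =>
    Fintype.ofFinite _
  have hsub : inducedCopies m (m + d) ⊆ (Finset.powersetCard m Finset.univ).biUnion
      fun X => Finset.univ.image (graphOver X) := by
    intro Z hZ
    obtain ⟨f, rfl⟩ := mem_inducedCopies.1 hZ
    obtain ⟨X, hX, φ, h⟩ := exists_range_eq_graphOver f
    simp only [Finset.mem_biUnion, Finset.mem_powersetCard, Finset.mem_image]
    exact ⟨X, ⟨Finset.subset_univ _, hX⟩, φ, Finset.mem_univ _, h.symm⟩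
  have hX : ∀ X ∈ Finset.powersetCard m (Finset.univ : Finset (Fin (m + d))),
      (Finset.univ.image (graphOver X)).card ≤ (3 ^ m.choose (m / 2)) ^ d := by
    intro X hX
    have hc := (Finset.mem_powersetCard.1 hX).2
    refine Finset.card_image_le.trans ?_
    have h1 := card_upperSet_finset_le X
    rw [Fintype.card_coe, hc, Nat.card_eq_fintype_card] at h1
    have h2 : Fintype.card {y // y ∉ X} = d := by
      rw [Fintype.card_subtype_compl]; simp [hc]
    rw [Finset.card_univ, Fintype.card_fun, h2]
    exact Nat.pow_le_pow_left h1 d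
  calc (inducedCopies m (m + d)).card ≤ _ := Finset.card_le_card hsub
    _ ≤ _ := Finset.card_biUnion_le_card_mul _ _ _ hX
    _ = (m + d).choose m * (3 ^ m.choose (m / 2)) ^ d := by simp
    _ ≤ (2 ^ m.choose (m / 2)) ^ d * (4 ^ m.choose (m / 2)) ^ d := by
        gcongr
        · exact (choose_add_le_pow m d).trans
            (Nat.pow_le_pow_left (succ_le_two_pow_choose_middle m) d)
        · norm_num
    _ = _ := by rw [← mul_pow, ← mul_pow, ← pow_mul]; norm_num

/-! ### Counting chains; monotonicity of the first bound -/

instance TChain.instFinite (α : Type*) [PartialOrder α] [Finite α] (t : ℕ) :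
    Finite (TChain α t) := by
  unfold TChain; infer_instance

/-- The image of a chain under an order embedding. -/
def TChain.map {α β : Type*} [PartialOrder α] [PartialOrder β] {t : ℕ} (f : α ↪o β)
    (C : TChain α t) : TChain β t :=
  ⟨C.val.map f.toEmbedding, by rw [Finset.card_map, C.2.1], by
    rintro _ hx _ hy hne
    simp only [Finset.coe_map, Set.mem_image] at hx hy
    obtain ⟨x, hx, rfl⟩ := hx
    obtain ⟨y, hy, rfl⟩ := hy
    have := C.2.2 hx hy (fun h => hne (by rw [h]))
    simpa using this⟩

theorem TChain.map_injective {α β : Type*} [PartialOrder α] [PartialOrder β] {t : ℕ}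
    (f : α ↪o β) : Function.Injective (TChain.map (t := t) f) := fun _ _ h =>
  Subtype.ext (Finset.map_injective _ (congrArg Subtype.val h))

/-- The chain of the values of a strictly monotone sequence. -/
def TChain.ofStrictMono {α : Type*} [PartialOrder α] {t : ℕ} (g : Fin t → α) (hg : StrictMono g) :
    TChain α t :=
  ⟨Finset.univ.map ⟨g, hg.injective⟩, by simp, by
    rintro _ hx _ hy hne
    simp only [Finset.coe_map, Set.mem_image] at hx hy
    obtain ⟨x, hx, rfl⟩ := hx
    obtain ⟨y, hy, rfl⟩ := hy
    exact (le_total x y).imp (fun h => hg.monotone h) (fun h => hg.monotone h)⟩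

theorem strictMono_initial {m t : ℕ} (h : t ≤ m + 1) :
    StrictMono fun j : Fin t => (Finset.univ.filter fun i : Fin m => i.val < j.val) := by
  intro j j' hj
  have hj' : j.val < j'.val := hj
  refine Finset.ssubset_iff_subset_ne.2 ⟨fun i hi => ?_, fun he => ?_⟩
  · simp at hi ⊢; omega
  · have := congrArg ((⟨j.val, by omega⟩ : Fin m) ∈ ·) he
    simp at this
    omega

theorem strictMono_final {m t : ℕ} (h : t ≤ m + 1) :
    StrictMono fun j : Fin t => (Finset.univ.filter fun i : Fin m => m ≤ i.val + j.val) := by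
  intro j j' hj
  have hj' : j.val < j'.val := hj
  refine Finset.ssubset_iff_subset_ne.2 ⟨fun i hi => ?_, fun he => ?_⟩
  · simp at hi ⊢; omega
  · have := congrArg ((⟨m - j'.val, by omega⟩ : Fin m) ∈ ·) he
    simp at this
    omega

theorem chainCount_pos {m t : ℕ} (h : t ≤ m + 1) : 1 ≤ chainCount m t := by
  have : Nonempty (TChain (BooleanLattice m) t) := ⟨.ofStrictMono _ (strictMono_initial h)⟩
  exact Nat.card_pos

/-- This makes the union bound strict. The witnesses differ because only the initial chain contains
the singleton of `0`. -/
theorem two_le_chainCount {m t : ℕ} (h : t ≤ m + 1) (ht : 2 ≤ t) (hm : 2 ≤ m) :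
    2 ≤ chainCount m t := by
  refine (Finite.one_lt_card_iff_nontrivial).2 ⟨.ofStrictMono _ (strictMono_initial h),
    .ofStrictMono _ (strictMono_final h), fun he => ?_⟩
  have he' := congrArg Subtype.val he
  have hmem : (Finset.univ.filter fun i : Fin m => i.val < 1) ∈
      (TChain.ofStrictMono _ (strictMono_initial h)).val :=
    Finset.mem_map.2 ⟨⟨1, by omega⟩, Finset.mem_univ _, rfl⟩
  rw [he'] at hmem
  obtain ⟨j, -, hj⟩ := Finset.mem_map.1 hmem
  have h0 := congrArg ((⟨0, by omega⟩ : Fin m) ∈ ·) hj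
  have h1 := congrArg ((⟨m - 1, by omega⟩ : Fin m) ∈ ·) hj
  simp at h0 h1
  omega

/-- The copy of `B_m` in `B_{m+1}` of the sets without the new point. -/
def lowerCopy (m : ℕ) : BooleanLattice m ↪o BooleanLattice (m + 1) :=
  Finset.mapEmbedding Fin.castSuccEmb

/-- The copy of `B_m` in `B_{m+1}` of the sets with the new point. -/
def upperCopy (m : ℕ) : BooleanLattice m ↪o BooleanLattice (m + 1) :=
  OrderEmbedding.ofMapLEIff (fun S => insert (Fin.last m) (lowerCopy m S)) fun S T => by
    constructor
    · intro h i hi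
      have := h (show i.castSucc ∈ _ by simp [lowerCopy, hi])
      simpa [lowerCopy, Fin.castSucc_ne_last] using this
    · intro h
      exact Finset.insert_subset_insert _ ((lowerCopy m).monotone h)

/-- The sets with and without the last point form two disjoint copies. -/
theorem two_mul_chainCount_le {m t : ℕ} (ht : 1 ≤ t) :
    2 * chainCount m t ≤ chainCount (m + 1) t := by
  have hinj : Function.Injective (Sum.elim (TChain.map (t := t) (lowerCopy m))
      (TChain.map (upperCopy m))) := by
    refine (TChain.map_injective _).sumElim (TChain.map_injective _) fun C D h => ?_
    have hne : D.val.Nonempty := Finset.card_pos.1 (by rw [D.2.1]; omega)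
    obtain ⟨S, hS⟩ := hne
    have hmem : upperCopy m S ∈ (TChain.map (upperCopy m) D).val := Finset.mem_map_of_mem _ hS
    rw [← h] at hmem
    obtain ⟨T, -, hT⟩ := Finset.mem_map.1 hmem
    have h1 := congrArg (Fin.last m ∈ ·) hT
    simp [lowerCopy, upperCopy] at h1
  have := Nat.card_le_card_of_injective _ hinj
  rw [Nat.card_sum] at this
  simp only [chainCount]
  omega

/-- The numerator is `(h - 1) * (1 + l)` with `l` the logarithm; `h - 1` at least doubles from `b`
to `b + 1`, while the middle binomial at most doubles. -/
theorem firstBound_mono {k t a b : ℕ} (hk : 3 ≤ k) (ht : 1 ≤ t) (hta : t ≤ a + 1) (hab : a ≤ b) :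
    firstBound k t a ≤ firstBound k t b := by
  induction b, hab using Nat.le_induction with
  | base => exact le_rfl
  | succ b hab ih =>
    refine ih.trans ?_
    have hlog : 0 ≤ Real.logb 2 ((k : ℝ) - 1) := by
      have : (3 : ℝ) ≤ k := by exact_mod_cast hk
      exact Real.logb_nonneg (by norm_num) (by linarith)
    have h1 : (1 : ℝ) ≤ chainCount b t := by exact_mod_cast chainCount_pos (by omega)
    have h2 : 2 * (chainCount b t : ℝ) ≤ chainCount (b + 1) t := by
      exact_mod_cast two_mul_chainCount_le ht
    have h3 : ((b + 1).choose ((b + 1) / 2) : ℝ) ≤ 2 * (b.choose (b / 2) : ℝ) := by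
      exact_mod_cast choose_succ_middle_le b
    have h4 : (0 : ℝ) < (b + 1).choose ((b + 1) / 2) := by
      exact_mod_cast Nat.choose_pos (by omega)
    have h5 : (0 : ℝ) < b.choose (b / 2) := by exact_mod_cast Nat.choose_pos (by omega)
    unfold firstBound
    set l := Real.logb 2 ((k : ℝ) - 1)
    set x := (chainCount b t : ℝ)
    set y := (chainCount (b + 1) t : ℝ)
    refine add_le_add (by push_cast; linarith) ?_
    rw [show x + (x - 1) * l - 1 = (x - 1) * (1 + l) by ring,
      show y + (y - 1) * l - 1 = (y - 1) * (1 + l) by ring,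
      div_le_div_iff₀ (by positivity) (by positivity)]
    have h6 : (x - 1) * ((b + 1).choose ((b + 1) / 2) : ℝ) ≤ (y - 1) * (b.choose (b / 2) : ℝ) :=
      calc _ ≤ (x - 1) * (2 * (b.choose (b / 2) : ℝ)) :=
            mul_le_mul_of_nonneg_left h3 (by linarith)
        _ = (2 * (x - 1)) * (b.choose (b / 2) : ℝ) := by ring
        _ ≤ _ := mul_le_mul_of_nonneg_right (by linarith) h5.le
    have := mul_le_mul_of_nonneg_right h6 (show 0 ≤ 4 * (1 + l) by linarith)
    linarith

/-! ### From the first bound to powers of `k` -/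

theorem eight_mul_pred_pow_lt {q : ℕ} (hq : 2 ≤ q) : (2 * q) ^ 3 < (q + 1) ^ 4 := by
  rcases lt_or_ge q 4 with h | h
  · interval_cases q <;> norm_num
  · nlinarith [pow_pos (show 0 < q by omega) 3, mul_le_mul_right h (q ^ 3)]

/-- If `N` is at most the first bound for `m`, the bound on the number of induced
copies of `B_m` in `B_N` is at most `k ^ (h_m(t) - 1)`. -/
theorem eight_pow_le {k t m N : ℕ} (hk : 3 ≤ k) (hN : (N : ℝ) ≤ firstBound k t m)
    (hh : 1 ≤ chainCount m t) :
    8 ^ (m.choose (m / 2) * (N - m)) ≤ k ^ (chainCount m t - 1) ∧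
    (2 ≤ chainCount m t → 8 ^ (m.choose (m / 2) * (N - m)) < k ^ (chainCount m t - 1)) := by
  obtain ⟨q, rfl⟩ : ∃ q, k = q + 1 := ⟨k - 1, by omega⟩
  obtain ⟨e, he⟩ : ∃ e, chainCount m t = e + 1 := ⟨chainCount m t - 1, by omega⟩
  unfold firstBound at hN
  rw [he] at hN ⊢
  set c := m.choose (m / 2) with hc
  have hcpos : (0 : ℝ) < c := by exact_mod_cast Nat.choose_pos (by omega)
  have hq : (2 : ℝ) ≤ q := by exact_mod_cast (show 2 ≤ q by omega)
  have hlog : 0 ≤ Real.logb 2 (q : ℝ) := Real.logb_nonneg (by norm_num) (by linarith)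
  -- This is the hypothesis on `N`, exponentiated to base 2.
  have key : 16 ^ (c * (N - m)) ≤ (2 * q) ^ e := by
    rcases lt_or_ge N m with hlt | hle
    · rw [Nat.sub_eq_zero_of_le hlt.le]
      simpa using Nat.one_le_pow e (2 * q) (by omega)
    obtain ⟨d, rfl⟩ := Nat.exists_eq_add_of_le hle
    rw [Nat.add_sub_cancel_left]
    push_cast at hN
    rw [add_le_add_iff_left, le_div_iff₀ (by positivity)] at hN
    simp only [add_sub_cancel_right] at hN
    have h1 : (d : ℝ) * (4 * c) * Real.log 2 ≤ e * (Real.log 2 + Real.log q) := by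
      have hl2 : 0 < Real.log 2 := Real.log_pos (by norm_num)
      have := mul_le_mul_of_nonneg_right hN hl2.le
      rw [Real.logb] at this
      have h3 : (e + 1 + e * (Real.log q / Real.log 2) - 1) * Real.log 2 =
          e * (Real.log 2 + Real.log q) := by field_simp; ring
      linarith
    have h2 : ((16 ^ (c * d) : ℕ) : ℝ) ≤ ((2 * q) ^ e : ℕ) := by
      push_cast
      rw [← Real.log_le_log_iff (by positivity) (by positivity), Real.log_pow, Real.log_pow,
        Real.log_mul (by norm_num) (by linarith), show (16 : ℝ) = 2 ^ 4 by norm_num, Real.log_pow]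
      push_cast
      linarith
    exact_mod_cast h2
  have h4 := eight_mul_pred_pow_lt (q := q) (by omega)
  -- Since `8 ^ 4 = 16 ^ 3`, fourth powers reduce the claim to `(2 * q) ^ 3 < (q + 1) ^ 4`.
  have h8 : (8 ^ (c * (N - m))) ^ 4 ≤ ((2 * q) ^ 3) ^ e := by
    calc (8 ^ (c * (N - m))) ^ 4 = (16 ^ (c * (N - m))) ^ 3 := by
          rw [pow_right_comm, pow_right_comm 16]; norm_num
      _ ≤ ((2 * q) ^ e) ^ 3 := Nat.pow_le_pow_left key 3
      _ = _ := pow_right_comm _ _ _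
  rw [Nat.add_sub_cancel]
  constructor
  · refine (Nat.pow_le_pow_iff_left (n := 4) (by norm_num)).1 (h8.trans ?_)
    rw [pow_right_comm (q + 1)]
    exact Nat.pow_le_pow_left h4.le e
  · intro h
    refine (Nat.pow_lt_pow_iff_left (n := 4) (by norm_num)).1 (h8.trans_lt ?_)
    rw [pow_right_comm (q + 1)]
    exact Nat.pow_lt_pow_left h4 (by omega)

/-! ### The union bound -/

theorem card_colorings_eq_on {T : Type*} [Fintype T] [DecidableEq T] {k : ℕ} (A : Finset T)
    (i : Fin k) : (Finset.univ.filter fun c : T → Fin k => ∀ C ∈ A, c C = i).card =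
      k ^ (Fintype.card T - A.card) := by
  have : (Finset.univ.filter fun c : T → Fin k => ∀ C ∈ A, c C = i) =
      Fintype.piFinset fun C => if C ∈ A then {i} else Finset.univ := by
    ext c
    simp only [Finset.mem_filter, Finset.mem_univ, true_and, Fintype.mem_piFinset]
    refine forall_congr' fun C => ?_
    split_ifs with h <;> simp [h]
  rw [this, Fintype.card_piFinset]
  simp only [apply_ite Finset.card, Finset.card_singleton, Finset.card_univ, Fintype.card_fin]
  rw [Finset.prod_ite]
  simp [Finset.filter_not, Finset.card_sdiff]

open Classical in
/-- The number of colorings with a copy of `B_m` in color `i`, by the union bound. -/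
theorem card_hasMonoInducedCopy_le {m N t k : ℕ} [Fintype (TChain (BooleanLattice N) t)]
    (i : Fin k) :
    (Finset.univ.filter fun c : TChain (BooleanLattice N) t → Fin k =>
      HasMonoInducedCopy c (BooleanLattice m) i).card ≤
    (inducedCopies m N).card *
      k ^ (Fintype.card (TChain (BooleanLattice N) t) - chainCount m t) := by
  have hsub : (Finset.univ.filter fun c : TChain (BooleanLattice N) t → Fin k =>
      HasMonoInducedCopy c (BooleanLattice m) i) ⊆ (inducedCopies m N).biUnion fun Z =>
        Finset.univ.filter fun c => ∀ C ∈ (Finset.univ.filter fun C : TChain (BooleanLattice N) t =>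
          (C.val : Set (BooleanLattice N)) ⊆ Z), c C = i := by
    intro c hc
    obtain ⟨f, hf⟩ := (Finset.mem_filter.1 hc).2
    simp only [Finset.mem_biUnion, Finset.mem_filter, Finset.mem_univ, true_and]
    exact ⟨Set.range f, mem_inducedCopies.2 ⟨f, rfl⟩, hf⟩
  refine (Finset.card_le_card hsub).trans (Finset.card_biUnion_le_card_mul _ _ _ fun Z hZ => ?_)
  obtain ⟨f, rfl⟩ := mem_inducedCopies.1 hZ
  rw [card_colorings_eq_on]
  refine Nat.pow_le_pow_right i.pos (Nat.sub_le_sub_left ?_ _)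
  have hinj : Function.Injective fun C : TChain (BooleanLattice m) t =>
      (⟨C.map f, Finset.mem_filter.2 ⟨Finset.mem_univ _, by
        simp [TChain.map]⟩⟩ :
        (Finset.univ.filter fun C : TChain (BooleanLattice N) t =>
          (C.val : Set (BooleanLattice N)) ⊆ Set.range f)) := fun C D h =>
    TChain.map_injective f (congrArg Subtype.val h)
  have := Nat.card_le_card_of_injective _ hinj
  rwa [Nat.card_eq_fintype_card (α := Finset.filter _ _), Fintype.card_coe] at this

theorem chainCount_le_of_inducedCopies_nonempty {m N t : ℕ} (h : (inducedCopies m N).Nonempty) :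
    chainCount m t ≤ Nat.card (TChain (BooleanLattice N) t) := by
  obtain ⟨Z, hZ⟩ := h
  obtain ⟨f, -⟩ := mem_inducedCopies.1 hZ
  exact Nat.card_le_card_of_injective _ (TChain.map_injective f)

theorem not_stronglyArrows {k t N : ℕ} (hk : 3 ≤ k) (ht : 2 ≤ t) (m : Fin k → ℕ)
    (htm : ∀ i, t ≤ m i + 1) (hN : ∀ i, (N : ℝ) ≤ firstBound k t (m i))
    (hbig : ∃ i, 2 ≤ m i) :
    ¬ StronglyArrows (BooleanLattice N) t (fun i => BooleanLattice (m i)) := by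
  classical
  intro harrow
  have : Fintype (TChain (BooleanLattice N) t) := Fintype.ofFinite _
  set H := Fintype.card (TChain (BooleanLattice N) t) with hH
  let bad : Fin k → Finset (TChain (BooleanLattice N) t → Fin k) := fun i =>
    Finset.univ.filter fun c => HasMonoInducedCopy c (BooleanLattice (m i)) i
  have hcover : (Finset.univ : Finset (TChain (BooleanLattice N) t → Fin k)) ⊆
      Finset.univ.biUnion bad := fun c _ => by
    simpa [bad] using harrow c
  have htotal : k ^ H ≤ ∑ i, (bad i).card := by
    have := (Finset.card_le_card hcover).trans Finset.card_biUnion_le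
    simpa [hH] using this
  have hkH : 0 < k ^ H := pow_pos (by omega) _
  have hbound : ∀ i, (bad i).card * k ≤ k ^ H ∧ (2 ≤ m i → (bad i).card * k < k ^ H) := by
    intro i
    have h1 : (bad i).card ≤ _ := card_hasMonoInducedCopy_le (m := m i) (N := N) (t := t) i
    have h2 := card_inducedCopies_le (m i) N
    have h3 := chainCount_pos (htm i)
    obtain ⟨h4, h5⟩ := eight_pow_le hk (hN i) h3
    -- A copy is needed to get `chainCount (m i) t ≤ H`; otherwise the exponent would truncate.
    rcases (inducedCopies (m i) N).eq_empty_or_nonempty with h | h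
    · have h0 : (bad i).card = 0 := by simpa [h] using h1
      simp [h0, hkH]
    have h6 := chainCount_le_of_inducedCopies_nonempty (t := t) h
    rw [Nat.card_eq_fintype_card, ← hH] at h6
    have h7 : k ^ (chainCount (m i) t - 1) * (k ^ (H - chainCount (m i) t) * k) = k ^ H := by
      rw [← pow_succ, ← pow_add]
      congr 1
      omega
    have h8 : 0 < k ^ (H - chainCount (m i) t) * k := by positivity
    have h9 : (bad i).card * k ≤
        (inducedCopies (m i) N).card * (k ^ (H - chainCount (m i) t) * k) := by
      rw [← mul_assoc]
      exact Nat.mul_le_mul_right k h1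
    rw [← h7]
    refine ⟨h9.trans (Nat.mul_le_mul_right _ (h2.trans h4)), fun h => h9.trans_lt ?_⟩
    exact Nat.mul_lt_mul_of_pos_right (h2.trans_lt (h5 (two_le_chainCount (htm i) ht h))) h8
  obtain ⟨i₀, hi₀⟩ := hbig
  have : ∑ i, (bad i).card * k < ∑ _i : Fin k, k ^ H :=
    Finset.sum_lt_sum (fun i _ => (hbound i).1) ⟨i₀, Finset.mem_univ _, (hbound i₀).2 hi₀⟩
  rw [← Finset.sum_mul] at this
  simp only [Finset.sum_const, Finset.card_univ, Fintype.card_fin, smul_eq_mul] at this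
  rw [mul_comm] at this
  exact absurd (Nat.lt_of_mul_lt_mul_left this) (not_lt.2 htotal)

/-! ### Passage to the Ramsey number -/

theorem lt_strongBooleanRamsey {k t : ℕ} {m : Fin k → ℕ} {x : ℝ}
    (h : ∀ N : ℕ, (N : ℝ) ≤ x →
      ¬ StronglyArrows (BooleanLattice N) t (fun i => BooleanLattice (m i))) :
    (x : EReal) < ((strongBooleanRamsey t m : ℝ≥0∞) : EReal) := by
  have h1 : ((⌊x⌋₊ + 1 : ℕ) : ℕ∞) ≤ strongBooleanRamsey t m := by
    refine le_iInf₂ fun N hN => ?_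
    have hx : x < N := not_le.1 fun hle => h N hle hN.2
    have := (Nat.floor_lt' (by omega)).2 hx
    exact_mod_cast this
  have h2 : (((⌊x⌋₊ + 1 : ℕ) : ℝ≥0∞) : EReal) ≤ ((strongBooleanRamsey t m : ℝ≥0∞) : EReal) :=
    EReal.coe_ennreal_le_coe_ennreal_iff.2 (by
      simpa only [ENat.toENNReal_coe] using ENat.toENNReal_le.2 h1)
  refine lt_of_lt_of_le ?_ h2
  calc (x : EReal) < ((⌊x⌋₊ + 1 : ℕ) : ℝ) :=
        EReal.coe_lt_coe_iff.2 (by exact_mod_cast Nat.lt_floor_add_one x)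
    _ = _ := by rw [← ENNReal.coe_natCast, EReal.coe_nnreal_eq_coe_real, NNReal.coe_natCast]

theorem theorem4p1 (k t : ℕ) (hk : 3 ≤ k) (m : Fin k → ℕ) (hm : Monotone m)
    (ht : 1 ≤ t - 1) (htm : t - 1 ≤ m ⟨0, by omega⟩)
    (hlast : 2 ≤ m ⟨k - 1, by omega⟩) :
    ((min (firstBound k t (m ⟨0, by omega⟩)) (secondBound t (m ⟨k - 1, by omega⟩)) : ℝ) : EReal)
      < ((strongBooleanRamsey t m : ℝ≥0∞) : EReal) := by
  refine lt_strongBooleanRamsey fun N hN => ?_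
  have h0 : ∀ i, m ⟨0, by omega⟩ ≤ m i := fun i => hm (Fin.le_def.2 (Nat.zero_le _))
  refine not_stronglyArrows hk (by omega) m (fun i => by have := h0 i; omega) (fun i => ?_)
    ⟨_, hlast⟩
  exact (hN.trans (min_le_left _ _)).trans (firstBound_mono hk (by omega) (by omega) (h0 i))
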